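/- Let $k$ be a field and let $G$ be a finite simple graph on $2d$ vertices, $d\ge 1$, with no isolated vertices, which is very well-covered, i.e. every maximal independent set of $G$ has exactly $d$ vertices. Let $\mathrm{Ind}(G)$ be the independence complex of $G$, whose faces are the independent sets of vertices (including $\emptyset$), and let $I(G)=(x_ux_v : \{u,v\}\in E(G))$ be the edge ideal of $G$ in the polynomial ring over $k$ with one variable for each vertex of $G$. Then $\mathrm{Ind}(G)$ is a pseudomanifold if and only if $I(G)$ is Cohen–Macaulay. Furthermore, if $\mathrm{Ind}(G)$ is a pseudomanifold, then $\mathrm{Ind}(G)$ has a boundary if and only if $G\ne dK_2$, that is, $G$ is not (isomorphic to) the graph consisting of $d$ disjoint edges. Here the following definitions are used. A face $F$ of a simplicial complex $\Delta$ has dimension $|F|-1$, and $\dim\Delta$ is the maximum of the dimensions of the faces. $\Delta$ is a *pseudomanifold* if (1) all its facets (maximal faces) have the same dimension; (2) every face of dimension $\dim\Delta-1$ belongs to at most two facets; and (3) for any two facets $F,F'$ there is a sequence of facets $F=G_0,G_1,\dots,G_t=F'$ with $\dim(G_i\cap G_{i+1})=\dim\Delta-1$ for $0\le i<t$. A pseudomanifold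 $\Delta$ *has a boundary* if some face of dimension $\dim\Delta-1$ belongs to exactly one facet. A squarefree monomial ideal $I$, with Stanley–Reisner complex $\Delta$ (the faces of $\Delta$ are the sets of variables whose product is not in $I$), is *Cohen–Macaulay* if for every face $F\in\Delta$, with $\mathrm{link}_\Delta(F)=\{H\in\Delta : H\cup F\in\Delta,\ H\cap F=\emptyset\}$, one has $\tilde H_i(\mathrm{link}_\Delta(F);k)=0$ for all $i<\dim \mathrm{link}_\Delta(F)$ (Reisner's criterion). -/

import Mathlib

/-! ### Simplicial complexes

An abstract simplicial complex on the vertex set `V` is a set of finite subsets of `V` that is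
closed under passing to subsets, i.e. a term of `LowerSet (Finset V)`.  The empty set is a face of
every complex that has a face at all. -/

namespace SComplex

variable {V : Type*}

/-- The dimension `|F| - 1` of a face; the empty face has dimension `-1`. -/
def faceDim (F : Finset V) : ℤ := (F.card : ℤ) - 1

/-- The dimension of a complex on a finite vertex set: the maximum of the dimensions of its
faces. -/
noncomputable def dim (Δ : LowerSet (Finset V)) : ℤ :=
  ((sSup (Finset.card '' (Δ : Set (Finset V))) : ℕ) : ℤ) - 1

/-- A facet is a face that is maximal under inclusion. -/
def IsFacet (Δ : LowerSet (Finset V)) (F : Finset V) : Prop :=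
  Maximal (fun G => G ∈ Δ) F

/-- A complex is pure if all its facets have the same dimension. -/
def IsPure (Δ : LowerSet (Finset V)) : Prop :=
  ∀ F F', IsFacet Δ F → IsFacet Δ F' → faceDim F = faceDim F'

/-- A ridge is a face of dimension `dim Δ - 1` that belongs to at most two facets. -/
def IsRidge (Δ : LowerSet (Finset V)) (H : Finset V) : Prop :=
  H ∈ Δ ∧ faceDim H = dim Δ - 1 ∧ {F | IsFacet Δ F ∧ H ⊆ F}.encard ≤ 2

/-- Any two facets are joined by a finite sequence of facets in which any two consecutive ones meet
in a face of dimension `dim Δ - 1`. -/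
def IsStronglyConnected [DecidableEq V] (Δ : LowerSet (Finset V)) : Prop :=
  ∀ F F', IsFacet Δ F → IsFacet Δ F' →
    Relation.ReflTransGen
      (fun A B => IsFacet Δ A ∧ IsFacet Δ B ∧ faceDim (A ∩ B) = dim Δ - 1) F F'

/-- A pseudomanifold is a pure, strongly connected complex in which every face of dimension
`dim Δ - 1` is a ridge. -/
structure IsPseudomanifold [DecidableEq V] (Δ : LowerSet (Finset V)) : Prop where
  pure : IsPure Δ
  ridge : ∀ H ∈ Δ, faceDim H = dim Δ - 1 → IsRidge Δ H
  stronglyConnected : IsStronglyConnected Δ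

/-- Some face of dimension `dim Δ - 1` belongs to exactly one facet. -/
def HasBoundary (Δ : LowerSet (Finset V)) : Prop :=
  ∃ H ∈ Δ, faceDim H = dim Δ - 1 ∧ ∃! F, IsFacet Δ F ∧ H ⊆ F

/-- The link of a set `F` of vertices: all faces `G` disjoint from `F` such that `G ∪ F` is a
face. -/
def link [DecidableEq V] (Δ : LowerSet (Finset V)) (F : Finset V) : LowerSet (Finset V) where
  carrier := {G | G ∈ Δ ∧ G ∪ F ∈ Δ ∧ Disjoint G F}
  lower' := fun _ _ hle h =>
    ⟨Δ.lower hle h.1, Δ.lower (Finset.union_subset_union_left hle) h.2.1,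
      Finset.disjoint_of_subset_left hle h.2.2⟩

/-! ### Reduced simplicial homology

The augmented oriented chain complex of `Δ` with coefficients in `k`, with respect to a fixed total
order `WellOrderingRel` on the vertices.  A face `{v₀ < ⋯ < vᵢ}` stands for the oriented simplex
`[v₀, …, vᵢ]`, and the empty face spans the chains of degree `-1`. -/

section Homology

variable (k : Type*) [Field k] [DecidableEq V]

open Classical in
/-- The position of `v` in `F`: the number of elements of `F` that come before `v`. -/
noncomputable def position (F : Finset V) (v : V) : ℕ :=
  (F.filter (fun u => WellOrderingRel u v)).card

/-- The boundary map `[v₀, …, vᵢ] ↦ ∑ⱼ (-1)ʲ [v₀, …, v̂ⱼ, …, vᵢ]`, in all degrees at once.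
In degree `0` it is the augmentation `[v] ↦ [∅]`. -/
noncomputable def boundary : (Finset V →₀ k) →ₗ[k] (Finset V →₀ k) :=
  Finsupp.linearCombination k fun F : Finset V =>
    ∑ v ∈ F, Finsupp.single (F.erase v) ((-1 : k) ^ position F v)

/-- The chains of degree `i`: linear combinations of the `i`-dimensional faces of `Δ`. -/
noncomputable def chains (Δ : LowerSet (Finset V)) (i : ℤ) : Submodule k (Finset V →₀ k) :=
  Finsupp.supported k k {F | F ∈ Δ ∧ faceDim F = i}

/-- The cycles of degree `i`. -/
noncomputable def cycles (Δ : LowerSet (Finset V)) (i : ℤ) : Submodule k (Finset V →₀ k) :=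
  chains k Δ i ⊓ LinearMap.ker (boundary k)

/-- The boundaries of degree `i`. -/
noncomputable def boundaries (Δ : LowerSet (Finset V)) (i : ℤ) : Submodule k (Finset V →₀ k) :=
  (chains k Δ (i + 1)).map (boundary k)

/-- The `i`-th reduced homology of `Δ` with coefficients in `k`: cycles modulo boundaries, realised
as the image of the cycles in the quotient of the space of all chains by the boundaries. -/
noncomputable def reducedHomology (Δ : LowerSet (Finset V)) (i : ℤ) :
    Submodule k ((Finset V →₀ k) ⧸ boundaries k Δ i) :=
  (cycles k Δ i).map (boundaries k Δ i).mkQ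

end Homology

/-! ### Squarefree monomial ideals and the Cohen-Macaulay property -/

/-- The Stanley-Reisner complex of a squarefree monomial ideal `I`: its faces are the sets `W` of
variables whose product does not lie in `I`. -/
noncomputable def stanleyReisnerComplex {k : Type*} [Field k] (I : Ideal (MvPolynomial V k)) :
    LowerSet (Finset V) where
  carrier := {W | ∏ v ∈ W, (MvPolynomial.X v : MvPolynomial V k) ∉ I}
  lower' := fun _ _ hle h h' => h (Ideal.mem_of_dvd I (Finset.prod_dvd_prod_of_subset _ _ _ hle) h')

/-- A squarefree monomial ideal `I` of a polynomial ring over the field `k` is Cohen-Macaulay if,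
for every face `F` of its Stanley-Reisner complex, the reduced homology over `k` of the link of `F`
vanishes in all degrees below the dimension of the link (Reisner's criterion). -/
def IsCohenMacaulay [DecidableEq V] {k : Type*} [Field k] (I : Ideal (MvPolynomial V k)) : Prop :=
  ∀ F ∈ stanleyReisnerComplex I, ∀ i : ℤ, i < dim (link (stanleyReisnerComplex I) F) →
    Subsingleton (reducedHomology k (link (stanleyReisnerComplex I) F) i)

end SComplex

/-! ### Graphs -/

namespace SimpleGraph

variable {V : Type*}

/-- The independence complex of a graph: its faces are the independent sets of vertices. -/
def independenceComplex (G : SimpleGraph V) : LowerSet (Finset V) where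
  carrier := {W | G.IsIndepSet (W : Set V)}
  lower' := fun _ _ hle h => h.mono (Finset.coe_subset.mpr hle)

/-- The edge ideal of a graph, generated by the products `x_u x_v` over all edges `uv`. -/
noncomputable def edgeIdeal (k : Type*) [Field k] (G : SimpleGraph V) : Ideal (MvPolynomial V k) :=
  Ideal.span {p | ∃ u v, G.Adj u v ∧ p = MvPolynomial.X u * MvPolynomial.X v}

/-- A finite graph is very well-covered if every maximal independent set has cardinality
`|V| / 2`. -/
def IsVeryWellCovered [Fintype V] (G : SimpleGraph V) : Prop :=
  ∀ W : Finset V, Maximal (fun W : Finset V => G.IsIndepSet (W : Set V)) W →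
    2 * W.card = Fintype.card V

/-- The graph `dK₂` of `d` disjoint edges: the `i`-th edge joins `(i, false)` and `(i, true)`. -/
def disjointEdges (d : ℕ) : SimpleGraph (Fin d × Bool) where
  Adj p q := p.1 = q.1 ∧ p.2 ≠ q.2
  symm := ⟨fun _ _ h => ⟨h.1.symm, h.2.symm⟩⟩
  loopless := ⟨fun _ h => h.2 rfl⟩

end SimpleGraph

/-!
A very well-covered graph `G` without isolated vertices has a perfect matching, by Hall's theorem:
an independent set never has fewer neighbours than elements
(`IsVeryWellCovered.card_le_card_neighbors`).  Let `σ` be the involution exchanging the ends of the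
matching edges.  Since no facet of `Ind(G)` may miss both `x` and `σ x`, each neighbour of `x` is
adjacent to each neighbour of `σ x`.  The facets thus contain exactly one end of every matching
edge, so `Ind(G)` is pure and a face of codimension one lies in at most two facets; being a
pseudomanifold amounts to strong connectedness.

Both strong connectedness and the Cohen-Macaulay property are equivalent to the absence of 4-cycles
through two matching edges (`IsUncrossed`).

* If `x, σ x, σ y, y` is such a 4-cycle, a facet contains `x` if and only if it contains `σ y`, so
  that no chain of facets leads from those containing `x` to those containing `σ x`
  (`IsFavaronMatching.isUncrossed_of_isStronglyConnected`).  Moreover, if `H` is maximal among the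
  independent sets avoiding the neighbours of `x` and of `σ x`, then the link of `H` is
  disconnected of positive dimension, which Reisner's criterion forbids
  (`IsFavaronMatching.isUncrossed_of_link`).
* If there is no such 4-cycle, every nonempty union of matching edges induces a subgraph with a leaf
  (`IsFavaronMatching.exists_leaf`).  Using leaves of the symmetric difference, one moves from a
  facet to another by exchanging `σ x` for `x` (`IsFavaronMatching.isStronglyConnected`).  The link
  of a face is the independence complex of an induced subgraph, in which a vertex whose partner is
  missing is isolated, so that the link is then a cone.  If every vertex has its partner, take a
  leaf `x`: the faces that avoid `σ x` form a cone with apex `x`, so the complex is the suspension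
  of the link of `σ x`, and induction applies (`IsFavaronMatching.subsingleton_reducedHomology`).

The homology of cones and suspensions is computed with explicit operators on the chains of the full
simplex (`SComplex.boundary_coneOp`, `SComplex.subsingleton_reducedHomology_of_suspension`).  The
boundary is empty exactly when all edges of `G` are matching edges
(`IsFavaronMatching.hasBoundary_iff`).
-/

namespace SComplex

variable {V : Type*}

/-! ### Elementary facts on dimensions -/

section Dimension

variable [Fintype V] {Δ : LowerSet (Finset V)}

lemma bddAbove_card (Δ : LowerSet (Finset V)) :
    BddAbove (Finset.card '' (Δ : Set (Finset V))) :=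
  ⟨Fintype.card V, by rintro _ ⟨F, -, rfl⟩; exact Finset.card_le_univ F⟩

lemma faceDim_le_dim {F : Finset V} (hF : F ∈ Δ) : faceDim F ≤ dim Δ := by
  have := le_csSup (bddAbove_card Δ) ⟨F, hF, rfl⟩
  unfold faceDim dim
  lia

lemma exists_faceDim_eq_dim {F : Finset V} (hF : F ∈ Δ) : ∃ A ∈ Δ, faceDim A = dim Δ := by
  obtain ⟨A, hA, h⟩ := Nat.sSup_mem (s := Finset.card '' (Δ : Set (Finset V)))
    ⟨_, F, hF, rfl⟩ (bddAbove_card Δ)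
  exact ⟨A, hA, by unfold faceDim dim; rw [h]⟩

lemma exists_isFacet_of_mem {F : Finset V} (hF : F ∈ Δ) : ∃ A, IsFacet Δ A ∧ F ⊆ A := by
  obtain ⟨A, hA, h⟩ := (Set.toFinite {G | G ∈ Δ}).exists_le_maximal hF
  exact ⟨A, h, hA⟩

end Dimension

/-! ### Operators on the augmented chain complex of a simplex -/

section Operators

lemma map_mem_of_mem_supported {k : Type*} [Field k] {s : Set (Finset V)} {z : Finset V →₀ k}
    (hz : z ∈ Finsupp.supported k k s) {M : Submodule k (Finset V →₀ k)}
    (L : (Finset V →₀ k) →ₗ[k] (Finset V →₀ k))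
    (h : ∀ F ∈ s, L (Finsupp.single F 1) ∈ M) : L z ∈ M := by
  rw [Finsupp.supported_eq_span_single] at hz
  refine (Submodule.span_le (p := M.comap L)).2 ?_ hz
  rintro _ ⟨F, hF, rfl⟩
  exact h F hF

lemma single_mem_chains {k : Type*} [Field k] {Δ : LowerSet (Finset V)} {F : Finset V} {i : ℤ}
    (hF : F ∈ Δ) (hi : faceDim F = i) (a : k) : Finsupp.single F a ∈ chains k Δ i :=
  Finsupp.single_mem_supported k a ⟨hF, hi⟩

variable (k : Type*) [Field k] [DecidableEq V]

/-- The cone operator with apex `v`, on the chains of the full simplex: it adds the vertex `v` in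
front of a face that does not contain `v`, and kills the other faces. -/
noncomputable def coneOp (v : V) : (Finset V →₀ k) →ₗ[k] (Finset V →₀ k) :=
  Finsupp.linearCombination k fun F : Finset V =>
    if v ∈ F then 0 else Finsupp.single (insert v F) ((-1 : k) ^ position F v)

/-- The operator that removes the vertex `v` from the faces that contain it, with the sign inverse
to that of `coneOp`, and kills the other faces.  It takes chains of a complex to chains of the link
of `v`. -/
noncomputable def linkOp (v : V) : (Finset V →₀ k) →ₗ[k] (Finset V →₀ k) :=
  Finsupp.linearCombination k fun F : Finset V =>
    if v ∈ F then Finsupp.single (F.erase v) ((-1 : k) ^ position F v) else 0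

variable {k}

lemma boundary_single (F : Finset V) : boundary k (Finsupp.single F 1) =
    ∑ v ∈ F, Finsupp.single (F.erase v) ((-1 : k) ^ position F v) := by
  simp [boundary]

lemma coneOp_single_of_notMem {v : V} {F : Finset V} (h : v ∉ F) (a : k) :
    coneOp k v (Finsupp.single F a) =
      Finsupp.single (insert v F) (a * (-1 : k) ^ position F v) := by
  simp [coneOp, h]

lemma coneOp_single_of_mem {v : V} {F : Finset V} (h : v ∈ F) (a : k) :
    coneOp k v (Finsupp.single F a) = 0 := by
  simp [coneOp, h]

lemma linkOp_single_of_mem {v : V} {F : Finset V} (h : v ∈ F) (a : k) :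
    linkOp k v (Finsupp.single F a) =
      Finsupp.single (F.erase v) (a * (-1 : k) ^ position F v) := by
  simp [linkOp, h]

lemma linkOp_single_of_notMem {v : V} {F : Finset V} (h : v ∉ F) (a : k) :
    linkOp k v (Finsupp.single F a) = 0 := by
  simp [linkOp, h]

lemma neg_one_pow_mul_self (n : ℕ) : (-1 : k) ^ n * (-1 : k) ^ n = 1 := by
  rw [← mul_pow]; simp

lemma position_erase_self (F : Finset V) (v : V) : position (F.erase v) v = position F v := by
  classical
  unfold position
  congr 1
  ext u
  simp only [Finset.mem_filter, Finset.mem_erase]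
  refine ⟨fun h => ⟨h.1.2, h.2⟩, fun h => ⟨⟨?_, h.1⟩, h.2⟩⟩
  rintro rfl
  exact irrefl_of WellOrderingRel _ h.2

lemma position_insert_self (F : Finset V) (v : V) : position (insert v F) v = position F v := by
  rw [← position_erase_self (insert v F), ← position_erase_self F, Finset.erase_insert_eq_erase]

open Classical in
lemma position_insert {F : Finset V} {u : V} (hu : u ∉ F) (v : V) :
    position (insert u F) v = position F v + if WellOrderingRel u v then 1 else 0 := by
  unfold position
  rw [Finset.filter_insert]
  split_ifs with h
  · rw [Finset.card_insert_of_notMem (by simp [hu])]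
  · rfl

/-- The two ways of removing `u` from `F` and adding `v` to it have opposite signs. -/
lemma sign_insert_erase {F : Finset V} {u v : V} (hu : u ∈ F) (hv : v ∉ F) :
    (-1 : k) ^ position F v * (-1 : k) ^ position (insert v F) u +
      (-1 : k) ^ position F u * (-1 : k) ^ position (F.erase u) v = 0 := by
  classical
  have huv : u ≠ v := fun h => hv (h ▸ hu)
  have h1 := position_insert (F := F.erase u) (Finset.notMem_erase u F) v
  rw [Finset.insert_erase hu] at h1
  rw [h1, position_insert hv u]
  rcases trichotomous_of WellOrderingRel u v with h | h | h
  · have h' : ¬ WellOrderingRel v u := fun h' => asymm_of WellOrderingRel h h'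
    simp only [h, h', if_true, if_false]
    ring
  · exact absurd h huv
  · have h' : ¬ WellOrderingRel u v := fun h' => asymm_of WellOrderingRel h h'
    simp only [h, h', if_true, if_false]
    ring

/-- The cone operator is a contracting homotopy of the full simplex. -/
lemma boundary_coneOp (v : V) (z : Finset V →₀ k) :
    boundary k (coneOp k v z) + coneOp k v (boundary k z) = z := by
  suffices h : boundary k ∘ₗ coneOp k v + coneOp k v ∘ₗ boundary k = LinearMap.id from
    LinearMap.congr_fun h z
  refine Finsupp.lhom_ext' fun F => LinearMap.ext_ring ?_
  simp only [LinearMap.comp_apply, LinearMap.add_apply, Finsupp.lsingle_apply, LinearMap.id_apply]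
  rw [boundary_single, map_sum]
  by_cases hv : v ∈ F
  · rw [coneOp_single_of_mem hv, map_zero, zero_add,
      Finset.sum_eq_single_of_mem v hv fun u hu huv =>
        coneOp_single_of_mem (Finset.mem_erase.2 ⟨huv.symm, hv⟩) _,
      coneOp_single_of_notMem (Finset.notMem_erase v F), position_erase_self,
      Finset.insert_erase hv, neg_one_pow_mul_self]
  · have hs : coneOp k v (Finsupp.single F 1) =
        (-1 : k) ^ position F v • Finsupp.single (insert v F) 1 := by
      rw [coneOp_single_of_notMem hv]; simp
    rw [hs, map_smul, boundary_single, Finset.sum_insert hv, Finset.erase_insert hv,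
      position_insert_self, smul_add, Finsupp.smul_single, smul_eq_mul, neg_one_pow_mul_self,
      add_assoc, Finset.smul_sum, ← Finset.sum_add_distrib, Finset.sum_eq_zero, add_zero]
    intro u hu
    have huv : u ≠ v := fun h => hv (h ▸ hu)
    rw [coneOp_single_of_notMem (fun h => hv (Finset.mem_of_mem_erase h)), Finsupp.smul_single,
      smul_eq_mul, Finset.erase_insert_of_ne huv.symm, ← Finsupp.single_add,
      sign_insert_erase hu hv, Finsupp.single_zero]

lemma coneOp_linkOp_add (v : V) (z : Finset V →₀ k) :
    coneOp k v (linkOp k v z) + linkOp k v (coneOp k v z) = z := by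
  suffices h : coneOp k v ∘ₗ linkOp k v + linkOp k v ∘ₗ coneOp k v = LinearMap.id from
    LinearMap.congr_fun h z
  refine Finsupp.lhom_ext' fun F => LinearMap.ext_ring ?_
  simp only [LinearMap.comp_apply, LinearMap.add_apply, Finsupp.lsingle_apply, LinearMap.id_apply]
  by_cases hv : v ∈ F
  · rw [linkOp_single_of_mem hv, coneOp_single_of_notMem (Finset.notMem_erase v F),
      coneOp_single_of_mem hv, map_zero, add_zero, Finset.insert_erase hv, position_erase_self,
      mul_assoc, neg_one_pow_mul_self, mul_one]
  · rw [linkOp_single_of_notMem hv, coneOp_single_of_notMem hv,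
      linkOp_single_of_mem (Finset.mem_insert_self v F), map_zero, zero_add,
      Finset.erase_insert hv, position_insert_self, mul_assoc, neg_one_pow_mul_self, mul_one]

/-- A face that contains `v` is, up to sign, the cone with apex `v` over the rest of the face. -/
lemma single_eq_smul_coneOp {v : V} {F : Finset V} (h : v ∈ F) :
    Finsupp.single F (1 : k) =
      (-1 : k) ^ position F v • coneOp k v (Finsupp.single (F.erase v) 1) := by
  rw [coneOp_single_of_notMem (Finset.notMem_erase v F), Finset.insert_erase h,
    position_erase_self, Finsupp.smul_single, smul_eq_mul, one_mul, neg_one_pow_mul_self]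

lemma boundary_boundary (z : Finset V →₀ k) : boundary k (boundary k z) = 0 := by
  suffices h : boundary k ∘ₗ boundary k = 0 by
    rw [← LinearMap.comp_apply, h, LinearMap.zero_apply]
  refine Finsupp.lhom_ext' fun F => LinearMap.ext_ring ?_
  simp only [LinearMap.comp_apply, Finsupp.lsingle_apply, LinearMap.zero_apply]
  induction F using Finset.induction_on with
  | empty => simp [boundary_single]
  | insert v F hv ih =>
    rw [single_eq_smul_coneOp (Finset.mem_insert_self v F), Finset.erase_insert hv, map_smul,
      map_smul]
    have h1 := boundary_coneOp v (Finsupp.single F (1 : k))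
    have h2 := boundary_coneOp v (boundary k (Finsupp.single F (1 : k)))
    rw [ih, map_zero, add_zero] at h2
    rw [eq_sub_of_add_eq h1, map_sub, h2, sub_self, smul_zero]

lemma linkOp_boundary_of_notMem {v : V} {F : Finset V} (h : v ∉ F) :
    linkOp k v (boundary k (Finsupp.single F 1)) = 0 := by
  rw [boundary_single, map_sum]
  exact Finset.sum_eq_zero fun u _ =>
    linkOp_single_of_notMem (fun h' => h (Finset.mem_of_mem_erase h')) _

lemma boundary_linkOp (v : V) (z : Finset V →₀ k) :
    boundary k (linkOp k v z) + linkOp k v (boundary k z) = 0 := by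
  suffices h : boundary k ∘ₗ linkOp k v + linkOp k v ∘ₗ boundary k = 0 from
    LinearMap.congr_fun h z
  refine Finsupp.lhom_ext' fun F => LinearMap.ext_ring ?_
  simp only [LinearMap.comp_apply, LinearMap.add_apply, Finsupp.lsingle_apply,
    LinearMap.zero_apply]
  by_cases hv : v ∈ F
  · set b : Finset V →₀ k := Finsupp.single (F.erase v) 1 with hb
    have hd : linkOp k v b = 0 := linkOp_single_of_notMem (Finset.notMem_erase v F) _
    have hdb : linkOp k v (boundary k b) = 0 := linkOp_boundary_of_notMem (Finset.notMem_erase v F)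
    have h1 := coneOp_linkOp_add v b
    have h2 := coneOp_linkOp_add v (boundary k b)
    rw [hd, map_zero, zero_add] at h1
    rw [hdb, map_zero, zero_add] at h2
    have h3 : boundary k (linkOp k v (coneOp k v b)) + linkOp k v (boundary k (coneOp k v b)) =
        0 := by
      rw [h1, eq_sub_of_add_eq (boundary_coneOp v b), map_sub, h2, hd, zero_sub, add_neg_cancel]
    rw [single_eq_smul_coneOp hv, ← hb, map_smul, map_smul, map_smul, map_smul, ← smul_add, h3,
      smul_zero]
  · rw [linkOp_single_of_notMem hv, linkOp_boundary_of_notMem hv, map_zero, add_zero]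

end Operators

/-! ### Vanishing of reduced homology -/

section Vanishing

variable {k : Type*} [Field k] [DecidableEq V] {Δ : LowerSet (Finset V)} {i : ℤ}

lemma subsingleton_reducedHomology_iff : Subsingleton (reducedHomology k Δ i) ↔
    ∀ z ∈ chains k Δ i, boundary k z = 0 → ∃ w ∈ chains k Δ (i + 1), boundary k w = z := by
  rw [Submodule.subsingleton_iff_eq_bot, reducedHomology, ← LinearMap.le_ker_iff_map,
    Submodule.ker_mkQ]
  exact ⟨fun h z hz hb => h ⟨hz, hb⟩, fun h z hz => h z hz.1 hz.2⟩

/-- There are no chains in degrees below `-1`. -/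
lemma subsingleton_reducedHomology_of_lt (hi : i < -1) :
    Subsingleton (reducedHomology k Δ i) := by
  refine subsingleton_reducedHomology_iff.2 fun z hz _ => ⟨0, zero_mem _, ?_⟩
  have h : {F | F ∈ Δ ∧ faceDim F = i} = ∅ := by
    ext F
    simp only [Set.mem_ofPred_eq, Set.mem_empty_iff_false, iff_false, faceDim]
    lia
  rw [chains, h, Finsupp.supported_empty, Submodule.mem_bot] at hz
  rw [hz, map_zero]

lemma subsingleton_reducedHomology_of_cone (v : V) (h : ∀ F ∈ Δ, insert v F ∈ Δ) :
    Subsingleton (reducedHomology k Δ i) := by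
  refine subsingleton_reducedHomology_iff.2 fun z hz hb => ⟨coneOp k v z, ?_, ?_⟩
  · refine map_mem_of_mem_supported hz _ fun F hF => ?_
    by_cases hv : v ∈ F
    · rw [coneOp_single_of_mem hv]; exact zero_mem _
    · rw [coneOp_single_of_notMem hv]
      refine single_mem_chains (h F hF.1) ?_ _
      have := hF.2
      simp only [faceDim, Finset.card_insert_of_notMem hv] at *
      push_cast
      lia
  · have := boundary_coneOp v z
    rwa [hb, map_zero, add_zero] at this

/-- If the faces that avoid `y` form a cone with apex `x`, then the complex is, up to homotopy, the
suspension of the link of `y`. -/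
lemma subsingleton_reducedHomology_of_suspension (x y : V)
    (h : ∀ F ∈ Δ, y ∉ F → insert x F ∈ Δ)
    (hlink : Subsingleton (reducedHomology k (link Δ {y}) (i - 1))) :
    Subsingleton (reducedHomology k Δ i) := by
  rw [subsingleton_reducedHomology_iff] at hlink ⊢
  intro z hz hb
  -- Removing `y` from the cycle `z` gives a cycle of the link of `y`, which bounds a chain `w`.
  obtain ⟨w, hw, hwz⟩ := hlink (linkOp k y z) (by
      refine map_mem_of_mem_supported hz _ fun F hF => ?_
      by_cases hy : y ∈ F
      · rw [linkOp_single_of_mem hy]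
        have hF2 := hF.2
        have hc := Finset.card_erase_add_one hy
        refine single_mem_chains (show F.erase y ∈ link Δ {y} from
          ⟨Δ.lower (Finset.erase_subset y F) hF.1, ?_, by simp⟩) ?_ _
        · rw [Finset.union_comm, ← Finset.insert_eq, Finset.insert_erase hy]
          exact hF.1
        · simp only [faceDim] at *
          lia
      · rw [linkOp_single_of_notMem hy]; exact zero_mem _)
    (by have := boundary_linkOp y z
        rwa [hb, map_zero, add_zero] at this)
  rw [sub_add_cancel] at hw
  -- The cycle `z + ∂ (y * w)` is homologous to `z` and avoids `y`.
  have hz' : z + boundary k (coneOp k y w) = w + linkOp k y (coneOp k y z) := by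
    have h1 := coneOp_linkOp_add y z
    have h2 := boundary_coneOp y w
    rw [hwz] at h2
    rw [eq_sub_of_add_eq h2, eq_sub_of_add_eq' h1]
    abel
  have hsupp : z + boundary k (coneOp k y w) ∈
      Finsupp.supported k k {F | (F ∈ Δ ∧ faceDim F = i) ∧ y ∉ F} := by
    rw [hz']
    refine add_mem (Finsupp.supported_mono ?_ hw) ?_
    · rintro F ⟨⟨hF, -, hd⟩, hi⟩
      exact ⟨⟨hF, hi⟩, by simpa using hd⟩
    · refine map_mem_of_mem_supported hz (linkOp k y ∘ₗ coneOp k y) fun F hF => ?_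
      rw [LinearMap.comp_apply]
      by_cases hy : y ∈ F
      · rw [coneOp_single_of_mem hy, map_zero]; exact zero_mem _
      · rw [coneOp_single_of_notMem hy, linkOp_single_of_mem (Finset.mem_insert_self y F),
          Finset.erase_insert hy]
        exact Finsupp.single_mem_supported k _ ⟨hF, hy⟩
  refine ⟨coneOp k x (z + boundary k (coneOp k y w)) - coneOp k y w, sub_mem ?_ ?_, ?_⟩
  · refine map_mem_of_mem_supported hsupp _ fun F hF => ?_
    by_cases hx : x ∈ F
    · rw [coneOp_single_of_mem hx]; exact zero_mem _
    · rw [coneOp_single_of_notMem hx]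
      refine single_mem_chains (h F hF.1.1 hF.2) ?_ _
      have := hF.1.2
      simp only [faceDim, Finset.card_insert_of_notMem hx] at *
      push_cast
      lia
  · refine map_mem_of_mem_supported hw _ fun F hF => ?_
    have hy : y ∉ F := by simpa using hF.1.2.2
    rw [coneOp_single_of_notMem hy]
    refine single_mem_chains ?_ ?_ _
    · rw [Finset.insert_eq, Finset.union_comm]; exact hF.1.2.1
    · have := hF.2
      simp only [faceDim, Finset.card_insert_of_notMem hy] at *
      push_cast
      lia
  · have h1 := boundary_coneOp x (z + boundary k (coneOp k y w))
    rw [map_add (boundary k), hb, boundary_boundary, zero_add, map_zero, add_zero] at h1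
    rw [map_sub, h1, add_sub_cancel_right]

/-- A complex is disconnected, and so has reduced homology in degree `0`, if no vertex with the
property `p` is joined to a vertex without it, and there are vertices of both kinds. -/
lemma not_subsingleton_reducedHomology_zero (p : V → Prop)
    (hΔ : ∀ a b, p a → ¬ p b → {a, b} ∉ Δ) {x y : V} (hx : {x} ∈ Δ) (hy : {y} ∈ Δ) (hpx : p x)
    (hpy : ¬ p y) : ¬ Subsingleton (reducedHomology k Δ 0) := by
  classical
  rw [subsingleton_reducedHomology_iff]
  intro h
  have hbd : ∀ v, boundary k (Finsupp.single ({v} : Finset V) 1) = Finsupp.single ∅ 1 := by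
    intro v
    rw [boundary_single, Finset.sum_singleton, ← position_erase_self]
    simp [position]
  obtain ⟨w, hw, hwz⟩ := h (Finsupp.single {x} 1 - Finsupp.single {y} 1)
    (sub_mem (single_mem_chains hx (by simp [faceDim]) _)
      (single_mem_chains hy (by simp [faceDim]) _))
    (by rw [map_sub, hbd, hbd, sub_self])
  -- The sum of the coefficients of a `0`-chain over the vertices with the property `p`.
  let φ : (Finset V →₀ k) →ₗ[k] k :=
    Finsupp.linearCombination k fun F => if ∃ v, F = {v} ∧ p v then 1 else 0
  have hφ : ∀ (v : V) (a : k), φ (Finsupp.single {v} a) = if p v then a else 0 := by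
    intro v a
    simp [φ]
  have hzero : φ (boundary k w) = 0 := by
    suffices hle : chains k Δ (0 + 1) ≤ LinearMap.ker (φ ∘ₗ boundary k) from hle hw
    rw [chains, Finsupp.supported_eq_span_single, Submodule.span_le]
    rintro _ ⟨F, ⟨hF, hdim⟩, rfl⟩
    obtain ⟨a, b, hab, rfl⟩ : ∃ a b, a ≠ b ∧ F = {a, b} := Finset.card_eq_two.1 (by
      unfold faceDim at hdim
      lia)
    have hp : p a ↔ p b := ⟨fun ha => by_contra fun hb => hΔ a b ha hb hF,
      fun hb => by_contra fun ha => hΔ b a hb ha (Finset.pair_comm a b ▸ hF)⟩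
    rw [SetLike.mem_coe, LinearMap.mem_ker, LinearMap.comp_apply]
    have he : boundary k (Finsupp.single ({a, b} : Finset V) 1) =
        (-1 : k) ^ position {a, b} a • Finsupp.single {b} 1 +
          (-1 : k) ^ position {a, b} b • Finsupp.single {a} 1 := by
      rw [boundary_single, Finset.sum_pair hab, Finset.erase_insert (by simpa using hab),
        Finset.pair_comm a b, Finset.erase_insert (by simpa using hab.symm)]
      simp
    -- The two coefficients of the boundary of an edge add up to zero because `∂ ∘ ∂ = 0`.
    have hsum := boundary_boundary (Finsupp.single ({a, b} : Finset V) (1 : k))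
    rw [he, map_add, map_smul, map_smul, hbd, hbd, ← add_smul] at hsum
    have hsum' := DFunLike.congr_fun hsum ∅
    simp only [Finsupp.smul_apply, Finsupp.single_eq_same, smul_eq_mul, mul_one,
      Finsupp.zero_apply] at hsum'
    rw [he, map_add, map_smul, map_smul, hφ, hφ, ← hp, ← add_smul, hsum', zero_smul]
  rw [hwz, map_sub, hφ, hφ, if_pos hpx, if_neg hpy, sub_zero] at hzero
  exact one_ne_zero hzero

end Vanishing

end SComplex

namespace SimpleGraph

open SComplex

variable {V : Type*} {G : SimpleGraph V} {σ : V → V}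

/-! ### Very well-covered graphs and their independence complexes -/

lemma mem_independenceComplex {W : Finset V} :
    W ∈ G.independenceComplex ↔ ∀ u ∈ W, ∀ v ∈ W, ¬ G.Adj u v := by
  refine ⟨fun h u hu v hv huv => h hu hv huv.ne huv, fun h u hu v hv _ => h u hu v hv⟩

lemma insert_mem_independenceComplex [DecidableEq V] {W : Finset V} {x : V}
    (hW : W ∈ G.independenceComplex) (hx : ∀ a ∈ W, ¬ G.Adj x a) :
    insert x W ∈ G.independenceComplex := by
  rw [mem_independenceComplex] at *
  simp only [Finset.mem_insert]
  rintro u (rfl | hu) v (rfl | hv) h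
  · exact G.irrefl h
  · exact hx v hv h
  · exact hx u hu h.symm
  · exact hW u hu v hv h

lemma singleton_mem_independenceComplex (x : V) : {x} ∈ G.independenceComplex := by
  simp [mem_independenceComplex]

section VeryWellCovered

variable [Fintype V]

lemma IsVeryWellCovered.two_mul_card_eq (h : G.IsVeryWellCovered) {F : Finset V}
    (hF : IsFacet G.independenceComplex F) : 2 * F.card = Fintype.card V :=
  h F hF

lemma IsVeryWellCovered.two_mul_card_le (h : G.IsVeryWellCovered) {W : Finset V}
    (hW : W ∈ G.independenceComplex) : 2 * W.card ≤ Fintype.card V := by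
  obtain ⟨F, hF, hWF⟩ := exists_isFacet_of_mem hW
  rw [← h.two_mul_card_eq hF]
  exact Nat.mul_le_mul_left 2 (Finset.card_le_card hWF)

lemma IsVeryWellCovered.faceDim_eq_dim (h : G.IsVeryWellCovered) {F : Finset V}
    (hF : IsFacet G.independenceComplex F) : faceDim F = dim G.independenceComplex := by
  obtain ⟨A, hA, hdim⟩ := exists_faceDim_eq_dim hF.prop
  have h1 := faceDim_le_dim hF.prop
  have h2 := h.two_mul_card_le hA
  have h3 := h.two_mul_card_eq hF
  rw [← hdim] at *
  unfold faceDim at *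
  lia

/-- An independent set `S` has at least `|S|` neighbours.  For a facet `A` that contains a neighbour
of `S`, the set `(A \ N(S)) ∪ (S \ A)` is independent, so `|S \ A| ≤ |A ∩ N(S)|`; the remaining part
`S ∩ A` of `S` is smaller than `S`, and its neighbours lie in `N(S) \ A`. -/
lemma IsVeryWellCovered.card_le_card_neighbors [DecidableEq V] [DecidableRel G.Adj]
    (h : G.IsVeryWellCovered) (hiso : ∀ v, ¬ G.IsIsolated v) (S : Finset V)
    (hS : S ∈ G.independenceComplex) :
    S.card ≤ (S.biUnion fun s => G.neighborFinset s).card := by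
  induction S using Finset.strongInduction with
  | H S ih =>
    obtain rfl | ⟨s, hs⟩ := S.eq_empty_or_nonempty
    · simp
    obtain ⟨u, hu⟩ : ∃ u, G.Adj s u := by
      simpa [SimpleGraph.IsIsolated] using hiso s
    obtain ⟨A, hA, huA⟩ := exists_isFacet_of_mem (singleton_mem_independenceComplex (G := G) u)
    have hsA : s ∉ A := fun h' =>
      mem_independenceComplex.1 hA.prop s h' u (huA (Finset.mem_singleton_self u)) hu
    have hlt : S ∩ A ⊂ S := Finset.ssubset_iff_of_subset Finset.inter_subset_left |>.2
      ⟨s, hs, fun h' => hsA (Finset.mem_inter.1 h').2⟩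
    have h1 := ih _ hlt (G.independenceComplex.lower hlt.subset hS)
    set N := S.biUnion fun s => G.neighborFinset s with hN
    have hsub : ((S ∩ A).biUnion fun s => G.neighborFinset s) ⊆ N \ A := by
      intro v hv
      simp only [hN, Finset.mem_biUnion, Finset.mem_inter, mem_neighborFinset,
        Finset.mem_sdiff] at *
      obtain ⟨a, ⟨haS, haA⟩, hav⟩ := hv
      exact ⟨⟨a, haS, hav⟩, fun hvA => mem_independenceComplex.1 hA.prop a haA v hvA hav⟩
    have h2 := Finset.card_le_card hsub
    have hind : (A \ N) ∪ (S \ A) ∈ G.independenceComplex := by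
      rw [mem_independenceComplex] at *
      have key : ∀ a ∈ A \ N, ∀ t ∈ S, ¬ G.Adj t a := fun a ha t ht hta =>
        (Finset.mem_sdiff.1 ha).2
          (Finset.mem_biUnion.2 ⟨t, ht, (mem_neighborFinset _ _ _).2 hta⟩)
      intro a ha b hb hab
      rcases Finset.mem_union.1 ha with ha | ha <;> rcases Finset.mem_union.1 hb with hb | hb
      · exact mem_independenceComplex.1 hA.prop a (Finset.mem_sdiff.1 ha).1 b
          (Finset.mem_sdiff.1 hb).1 hab
      · exact key a ha b (Finset.mem_sdiff.1 hb).1 hab.symm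
      · exact key b hb a (Finset.mem_sdiff.1 ha).1 hab
      · exact hS a (Finset.mem_sdiff.1 ha).1 b (Finset.mem_sdiff.1 hb).1 hab
    have h3 := h.two_mul_card_le hind
    rw [Finset.card_union_of_disjoint (Finset.disjoint_left.2 fun a ha hb =>
      (Finset.mem_sdiff.1 hb).2 (Finset.mem_sdiff.1 ha).1)] at h3
    have h4 := h.two_mul_card_eq hA
    have h5 := Finset.card_sdiff_add_card_inter A N
    have h6 := Finset.card_sdiff_add_card_inter N A
    have h7 := Finset.card_sdiff_add_card_inter S A
    rw [Finset.inter_comm] at h6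
    lia

end VeryWellCovered

/-! ### The matching of a very well-covered graph -/

/-- A perfect matching of `G`, given by the involution `σ` that exchanges the ends of each of its
edges, such that every neighbour of one end of a matching edge is adjacent to every neighbour of
the other end.  As `G` has no loops, the two ends then have no common neighbour. -/
structure IsFavaronMatching (G : SimpleGraph V) (σ : V → V) : Prop where
  invol : ∀ v, σ (σ v) = v
  adj : ∀ v, G.Adj v (σ v)
  join : ∀ {x a b}, G.Adj x a → G.Adj (σ x) b → G.Adj a b

/-- No two distinct edges of the matching lie on a common 4-cycle. -/
def IsUncrossed (G : SimpleGraph V) (σ : V → V) : Prop :=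
  ∀ x y, G.Adj x y → G.Adj (σ x) (σ y) → y = σ x

lemma IsFavaronMatching.not_adj (hσ : G.IsFavaronMatching σ) {x a : V} (h : G.Adj x a) :
    ¬ G.Adj (σ x) a := fun h' => G.irrefl (hσ.join h h')

/-- If some facet missed both `x` and `σ x`, it would contain a neighbour of each, and these two
neighbours are adjacent. -/
lemma IsFavaronMatching.mem_or_mem [DecidableEq V] (hσ : G.IsFavaronMatching σ) {F : Finset V}
    (hF : IsFacet G.independenceComplex F) (x : V) : x ∈ F ∨ σ x ∈ F := by
  have key : ∀ v, v ∉ F → ∃ a ∈ F, G.Adj v a := by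
    intro v hv
    by_contra! hc
    exact hv (hF.le_of_ge (insert_mem_independenceComplex hF.prop hc) (Finset.subset_insert v F)
      (Finset.mem_insert_self v F))
  by_contra! hx
  obtain ⟨a, ha, hxa⟩ := key _ hx.1
  obtain ⟨b, hb, hxb⟩ := key _ hx.2
  exact mem_independenceComplex.1 hF.prop a ha b hb (hσ.join hxa hxb)

lemma two_mul_card_le_of_involution [DecidableEq V] (hinv : ∀ v, σ (σ v) = v)
    (hadj : ∀ v, G.Adj v (σ v)) {A W : Finset V} (hA : A ∈ G.independenceComplex)
    (hAW : A ⊆ W) (hW : ∀ v ∈ W, σ v ∈ W) :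
    2 * A.card ≤ W.card := by
  have hdisj : Disjoint A (A.image σ) := by
    rw [Finset.disjoint_left]
    intro v hv hv'
    obtain ⟨w, hw, rfl⟩ := Finset.mem_image.1 hv'
    exact mem_independenceComplex.1 hA w hw _ hv (hadj w)
  have h1 : A ∪ A.image σ ⊆ W := by
    refine Finset.union_subset hAW fun v hv => ?_
    obtain ⟨w, hw, rfl⟩ := Finset.mem_image.1 hv
    exact hW w (hAW hw)
  have h2 := Finset.card_le_card h1
  rw [Finset.card_union_of_disjoint hdisj,
    Finset.card_image_of_injective _ (Function.LeftInverse.injective hinv)] at h2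
  lia

/-- The matching comes from Hall's theorem, applied to the neighbourhoods of the vertices of a
facet. -/
lemma IsVeryWellCovered.exists_isFavaronMatching [Fintype V] (h : G.IsVeryWellCovered)
    (hiso : ∀ v, ¬ G.IsIsolated v) : ∃ σ, G.IsFavaronMatching σ := by
  classical
  obtain ⟨F, hF, -⟩ := exists_isFacet_of_mem (Δ := G.independenceComplex) (F := ∅)
    (by simp [mem_independenceComplex])
  have hind := mem_independenceComplex.1 hF.prop
  obtain ⟨f, hf, hadj⟩ := (Finset.all_card_le_biUnion_card_iff_exists_injective
    fun v : F => G.neighborFinset (v : V)).1 fun s => by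
      have hs : s.map (Function.Embedding.subtype _) ∈ G.independenceComplex :=
        G.independenceComplex.lower (fun v hv => by
          obtain ⟨w, -, rfl⟩ := Finset.mem_map.1 hv
          exact w.2) hF.prop
      have := h.card_le_card_neighbors hiso _ hs
      rw [Finset.card_map] at this
      refine this.trans (Finset.card_le_card fun v hv => ?_)
      simp only [Finset.mem_biUnion, Finset.mem_map, mem_neighborFinset] at *
      obtain ⟨_, ⟨w, hw, rfl⟩, hv⟩ := hv
      exact ⟨w, hw, hv⟩
  simp only [mem_neighborFinset] at hadj
  have hfF : ∀ v, f v ∉ F := fun v hv => hind v v.2 _ hv (hadj v)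
  have hsurj : ∀ v, v ∉ F → ∃ w, f w = v := by
    have himage : Finset.univ.image f = Fᶜ := by
      refine Finset.eq_of_subset_of_card_le (fun v hv => ?_) ?_
      · obtain ⟨w, -, rfl⟩ := Finset.mem_image.1 hv
        exact Finset.mem_compl.2 (hfF w)
      · have := h.two_mul_card_eq hF
        rw [Finset.card_image_of_injective _ hf, Finset.card_compl, Finset.card_univ,
          Fintype.card_coe]
        lia
    intro v hv
    obtain ⟨w, -, hw⟩ := Finset.mem_image.1 (himage ▸ Finset.mem_compl.2 hv)
    exact ⟨w, hw⟩
  choose g hg using hsurj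
  have hgf : ∀ w, g (f w) (hfF w) = w := fun w => hf (hg _ _)
  let σ : V → V := fun v => if hv : v ∈ F then f ⟨v, hv⟩ else g v hv
  have hσ : ∀ v, G.Adj v (σ v) := by
    intro v
    by_cases hv : v ∈ F
    · simp only [σ, dif_pos hv]
      exact hadj ⟨v, hv⟩
    · simp only [σ, dif_neg hv]
      have := hadj (g v hv)
      rw [hg] at this
      exact this.symm
  have hinv : ∀ v, σ (σ v) = v := by
    intro v
    by_cases hv : v ∈ F
    · simp only [σ, dif_pos hv, dif_neg (hfF _), hgf]
    · simp only [σ, dif_neg hv, dif_pos (g v hv).2, Subtype.coe_eta, hg]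
  refine ⟨σ, hinv, hσ, fun {x a b} hxa hxb => ?_⟩
  -- Otherwise `{a, b}` is independent, and a facet containing it meets neither `x` nor `σ x`;
  -- as it meets every matching edge at most once, it is too small.
  by_contra hab
  have hpair : insert a {b} ∈ G.independenceComplex :=
    insert_mem_independenceComplex (singleton_mem_independenceComplex b) (by simpa using hab)
  obtain ⟨A, hA, habA⟩ := exists_isFacet_of_mem hpair
  have hA' := mem_independenceComplex.1 hA.prop
  have hxA : x ∉ A := fun hx => hA' x hx a (habA (by simp)) hxa
  have hσxA : σ x ∉ A := fun hx => hA' _ hx b (habA (by simp)) hxb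
  have h1 := two_mul_card_le_of_involution hinv hσ hA.prop (W := {x, σ x}ᶜ)
    (fun v hv => by
      simp only [Finset.mem_compl, Finset.mem_insert, Finset.mem_singleton]
      rintro (rfl | rfl)
      exacts [hxA hv, hσxA hv])
    (fun v hv => by
      simp only [Finset.mem_compl, Finset.mem_insert, Finset.mem_singleton] at *
      rintro (h' | h')
      · exact hv (Or.inr (by rw [← h', hinv]))
      · exact hv (Or.inl (by rw [← hinv v, h', hinv])))
  have h2 := h.two_mul_card_eq hA
  rw [Finset.card_compl, Finset.card_pair (hσ x).ne] at h1
  have h3 := (Finset.card_pair (hσ x).ne).symm.trans_le (Finset.card_le_univ _)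
  lia

/-- A vertex `x` of minimal degree in the subgraph induced on `D` is a leaf: if it had a neighbour
`a ≠ σ x`, then all neighbours of `σ a` would be neighbours of `x`, but `σ x` is a neighbour of `x`
and, the matching being uncrossed, not of `σ a`. -/
lemma IsFavaronMatching.exists_leaf (hσ : G.IsFavaronMatching σ) (hu : G.IsUncrossed σ)
    {D : Finset V} (hD : ∀ v ∈ D, σ v ∈ D) (hne : D.Nonempty) :
    ∃ x ∈ D, ∀ a ∈ D, G.Adj x a → a = σ x := by
  classical
  obtain ⟨x, hx, hmin⟩ := D.exists_min_image (fun x => (D.filter (G.Adj x)).card) hne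
  refine ⟨x, hx, fun a ha hxa => hu x a hxa ?_⟩
  have hsub : D.filter (G.Adj (σ a)) ⊆ D.filter (G.Adj x) := by
    intro b hb
    rw [Finset.mem_filter] at *
    exact ⟨hb.1, hσ.join hxa.symm hb.2⟩
  have heq := Finset.eq_of_subset_of_card_le hsub (hmin _ (hD a ha))
  have hmem : σ x ∈ D.filter (G.Adj (σ a)) :=
    heq ▸ Finset.mem_filter.2 ⟨hD x hx, hσ.adj x⟩
  exact (Finset.mem_filter.1 hmem).2.symm

/-! ### Facets, ridges and strong connectedness -/

section Facets

variable [Fintype V] [DecidableEq V]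

/-- If `σ x` is the only neighbour of `x` in a facet, exchanging `σ x` for `x` gives a facet. -/
lemma IsFavaronMatching.isFacet_flip (hσ : G.IsFavaronMatching σ) (h : G.IsVeryWellCovered)
    {F : Finset V} (hF : IsFacet G.independenceComplex F) {x : V} (hx : x ∉ F)
    (hleaf : ∀ a ∈ F, G.Adj x a → a = σ x) :
    IsFacet G.independenceComplex (insert x (F.erase (σ x))) := by
  have hmem : insert x (F.erase (σ x)) ∈ G.independenceComplex :=
    insert_mem_independenceComplex (G.independenceComplex.lower (Finset.erase_subset _ _) hF.prop)
      fun a ha hxa => (Finset.mem_erase.1 ha).1 (hleaf a (Finset.mem_erase.1 ha).2 hxa)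
  obtain ⟨A, hA, hsub⟩ := exists_isFacet_of_mem hmem
  have h1 := h.two_mul_card_eq hA
  have h2 := h.two_mul_card_eq hF
  have h3 := Finset.card_erase_add_one ((hσ.mem_or_mem hF x).resolve_left hx)
  rwa [Finset.eq_of_subset_of_card_le hsub]
  rw [Finset.card_insert_of_notMem fun h' => hx (Finset.mem_of_mem_erase h')]
  lia

/-- A face of codimension one misses exactly one edge of the matching, and is completed to a facet
only by an end of it. -/
lemma IsFavaronMatching.isRidge (hσ : G.IsFavaronMatching σ)
    (h : G.IsVeryWellCovered) {H : Finset V} (hH : H ∈ G.independenceComplex)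
    (hdim : faceDim H = dim G.independenceComplex - 1) : IsRidge G.independenceComplex H := by
  refine ⟨hH, hdim, ?_⟩
  obtain ⟨F, hF, hHF⟩ := exists_isFacet_of_mem hH
  obtain ⟨x, hxF, hxH⟩ : ∃ x ∈ F, x ∉ H := by
    by_contra! hc
    rw [← h.faceDim_eq_dim hF, hHF.antisymm hc] at hdim
    lia
  have hσxH : σ x ∉ H := fun h' =>
    mem_independenceComplex.1 hF.prop x hxF _ (hHF h') (hσ.adj x)
  have hsub : {A | IsFacet G.independenceComplex A ∧ H ⊆ A} ⊆ {insert x H, insert (σ x) H} := by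
    rintro A ⟨hA, hHA⟩
    have key : ∀ v ∈ A, v ∉ H → A = insert v H := by
      intro v hv hvH
      refine (Finset.eq_of_subset_of_card_le (Finset.insert_subset hv hHA) ?_).symm
      rw [Finset.card_insert_of_notMem hvH]
      rw [← h.faceDim_eq_dim hA] at hdim
      unfold faceDim at hdim
      lia
    rcases hσ.mem_or_mem hA x with h' | h'
    · exact Or.inl (key _ h' hxH)
    · exact Or.inr (key _ h' hσxH)
  exact (Set.encard_le_encard hsub).trans ((Set.encard_insert_le _ _).trans (by
    rw [Set.encard_singleton, one_add_one_eq_two]))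

/-- The symmetric difference of two facets is a union of matching edges; exchanging the ends of the
matching edge at a leaf of it, in one of the facets, brings the two closer. -/
lemma IsFavaronMatching.isStronglyConnected (hσ : G.IsFavaronMatching σ)
    (h : G.IsVeryWellCovered) (hu : G.IsUncrossed σ) :
    IsStronglyConnected G.independenceComplex := by
  intro F F' hF hF'
  -- A single exchange towards `F'`.
  have step : ∀ A B, IsFacet G.independenceComplex A → IsFacet G.independenceComplex B →
      ∀ x ∈ B, x ∉ A → (∀ a ∈ symmDiff A B, G.Adj x a → a = σ x) →
      IsFacet G.independenceComplex (insert x (A.erase (σ x))) ∧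
      faceDim (A ∩ insert x (A.erase (σ x))) = dim G.independenceComplex - 1 ∧
      (symmDiff (insert x (A.erase (σ x))) B).card < (symmDiff A B).card := by
    intro A B hA hB x hxB hxA hleaf
    have hBi := mem_independenceComplex.1 hB.prop
    have hσA := (hσ.mem_or_mem hA x).resolve_left hxA
    have hσB : σ x ∉ B := fun h' => hBi x hxB _ h' (hσ.adj x)
    refine ⟨hσ.isFacet_flip h hA hxA fun a ha hxa => hleaf a ?_ hxa, ?_, ?_⟩
    · exact Finset.mem_symmDiff.2 (Or.inl ⟨ha, fun haB => hBi x hxB a haB hxa⟩)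
    · have heq : A ∩ insert x (A.erase (σ x)) = A.erase (σ x) := by
        rw [Finset.inter_insert_of_notMem hxA, Finset.inter_eq_right]
        exact Finset.erase_subset _ _
      rw [heq, ← h.faceDim_eq_dim hA]
      have := Finset.card_erase_add_one hσA
      unfold faceDim
      lia
    · refine Finset.card_lt_card (Finset.ssubset_iff_of_subset ?_ |>.2 ⟨x, ?_, ?_⟩)
      · intro v hv
        simp only [Finset.mem_symmDiff, Finset.mem_insert, Finset.mem_erase] at *
        grind
      · exact Finset.mem_symmDiff.2 (Or.inr ⟨hxB, hxA⟩)
      · simp [Finset.mem_symmDiff, hxB]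
  generalize hn : (symmDiff F F').card = n
  induction n using Nat.strong_induction_on generalizing F F' with
  | _ n ih =>
    obtain hD | hD := (symmDiff F F').eq_empty_or_nonempty
    · rw [symmDiff_eq_bot.1 hD]
    obtain ⟨x, hx, hleaf⟩ := hσ.exists_leaf hu (D := symmDiff F F') (by
      have h1 := mem_independenceComplex.1 hF.prop
      have h2 := mem_independenceComplex.1 hF'.prop
      intro v hv
      rcases Finset.mem_symmDiff.1 hv with ⟨hv, hv'⟩ | ⟨hv, hv'⟩
      · exact Finset.mem_symmDiff.2 (Or.inr ⟨(hσ.mem_or_mem hF' v).resolve_left hv',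
          fun h' => h1 v hv _ h' (hσ.adj v)⟩)
      · exact Finset.mem_symmDiff.2 (Or.inl ⟨(hσ.mem_or_mem hF v).resolve_left hv',
          fun h' => h2 v hv _ h' (hσ.adj v)⟩)) hD
    rcases Finset.mem_symmDiff.1 hx with ⟨hxF, hxF'⟩ | ⟨hxF', hxF⟩
    · rw [symmDiff_comm] at hn hleaf
      obtain ⟨h1, h2, h3⟩ := step F' F hF' hF x hxF hxF' hleaf
      rw [symmDiff_comm] at h3
      refine Relation.ReflTransGen.tail (ih _ (hn ▸ h3) _ _ hF h1 rfl) ⟨h1, hF', ?_⟩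
      rwa [Finset.inter_comm]
    · obtain ⟨h1, h2, h3⟩ := step F F' hF hF' x hxF' hxF hleaf
      exact Relation.ReflTransGen.head ⟨hF, h1, h2⟩ (ih _ (hn ▸ h3) _ _ h1 hF' rfl)

/-- If the edges at `x` and `y` of the matching lie on a 4-cycle, then a facet contains `x` if and
only if it contains `σ y`, so that a facet containing `x` is only adjacent to facets containing
`x`. -/
lemma IsFavaronMatching.isUncrossed_of_isStronglyConnected (hσ : G.IsFavaronMatching σ)
    (h : G.IsVeryWellCovered) (hsc : IsStronglyConnected G.independenceComplex) :
    G.IsUncrossed σ := by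
  intro x y hxy hxy'
  by_contra hne
  obtain ⟨F, hF, hxF⟩ := exists_isFacet_of_mem (singleton_mem_independenceComplex (G := G) x)
  obtain ⟨F', hF', hxF'⟩ :=
    exists_isFacet_of_mem (singleton_mem_independenceComplex (G := G) (σ x))
  rw [Finset.singleton_subset_iff] at hxF hxF'
  suffices hmem : x ∈ F' from mem_independenceComplex.1 hF'.prop x hmem _ hxF' (hσ.adj x)
  have hpath := hsc F F' hF hF'
  clear hF' hxF'
  induction hpath with
  | refl => exact hxF
  | @tail A B _ hAB ih =>
    obtain ⟨hA, hB, hdim⟩ := hAB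
    have hAi := mem_independenceComplex.1 hA.prop
    have hBi := mem_independenceComplex.1 hB.prop
    by_contra hxB
    have hσyA := (hσ.mem_or_mem hA y).resolve_left fun hy => hAi x ih y hy hxy
    have hσxB := (hσ.mem_or_mem hB x).resolve_left hxB
    have hσyB : σ y ∉ B := fun hy => hBi _ hσxB _ hy hxy'
    have hcard : (A \ B).card ≤ 1 := by
      have h1 := Finset.card_sdiff_add_card_inter A B
      rw [← h.faceDim_eq_dim hA] at hdim
      unfold faceDim at hdim
      lia
    have heq := Finset.card_le_one.1 hcard x (Finset.mem_sdiff.2 ⟨ih, hxB⟩) (σ y)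
      (Finset.mem_sdiff.2 ⟨hσyA, hσyB⟩)
    exact hne (by rw [heq, hσ.invol])

end Facets

/-! ### Uncrossed matchings give Cohen-Macaulay edge ideals -/

/-- The independence complex of the subgraph induced on `W`, as a complex on the same vertex type
`V`. -/
def independenceComplexOn (G : SimpleGraph V) (W : Finset V) : LowerSet (Finset V) where
  carrier := {F | F ∈ G.independenceComplex ∧ F ⊆ W}
  lower' := fun _ _ hle h => ⟨G.independenceComplex.lower hle h.1, hle.trans h.2⟩

lemma independenceComplexOn_univ [Fintype V] :
    G.independenceComplexOn Finset.univ = G.independenceComplex :=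
  SetLike.ext fun F => show F ∈ _ ∧ F ⊆ _ ↔ _ from
    ⟨fun h => h.1, fun h => ⟨h, Finset.subset_univ _⟩⟩

/-- The vertices of `W` that neither lie in `F` nor have a neighbour in `F`. -/
noncomputable def nonNeighbors (G : SimpleGraph V) (W F : Finset V) : Finset V := by
  classical exact W.filter fun v => v ∉ F ∧ ∀ u ∈ F, ¬ G.Adj u v

lemma mem_nonNeighbors {W F : Finset V} {v : V} :
    v ∈ G.nonNeighbors W F ↔ v ∈ W ∧ v ∉ F ∧ ∀ u ∈ F, ¬ G.Adj u v := by
  simp [nonNeighbors]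

lemma link_independenceComplexOn [DecidableEq V] {W F : Finset V}
    (hF : F ∈ G.independenceComplexOn W) :
    link (G.independenceComplexOn W) F = G.independenceComplexOn (G.nonNeighbors W F) := by
  ext A
  refine ⟨fun ⟨h1, h2, h3⟩ => ⟨h1.1, fun v hv => ?_⟩, fun ⟨h1, h2⟩ => ?_⟩
  · exact mem_nonNeighbors.2 ⟨h1.2 hv, Finset.disjoint_left.1 h3 hv, fun u hu =>
      mem_independenceComplex.1 h2.1 u (Finset.mem_union_right A hu) v
        (Finset.mem_union_left F hv)⟩
  · have h2' := fun v (hv : v ∈ A) => mem_nonNeighbors.1 (h2 hv)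
    have hAW : A ⊆ W := fun v hv => (h2' v hv).1
    refine ⟨⟨h1, hAW⟩, ⟨?_, Finset.union_subset hAW hF.2⟩,
      Finset.disjoint_left.2 fun v hv => (h2' v hv).2.1⟩
    have hFi := mem_independenceComplex.1 hF.1
    rw [mem_independenceComplex] at *
    intro a ha b hb hab
    rcases Finset.mem_union.1 ha with ha | ha <;> rcases Finset.mem_union.1 hb with hb | hb
    · exact h1 a ha b hb hab
    · exact (h2' a ha).2.2 b hb hab.symm
    · exact (h2' b hb).2.2 a ha hab
    · exact hFi a ha b hb hab

section Homology

variable {k : Type*} [Field k] [DecidableEq V]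

/-- If the subgraph induced on `W` has an isolated vertex, its independence complex is a cone. -/
lemma subsingleton_reducedHomology_of_isolated {W : Finset V} {v : V} (hv : v ∈ W)
    (hiso : ∀ w ∈ W, ¬ G.Adj v w) (i : ℤ) :
    Subsingleton (reducedHomology k (G.independenceComplexOn W) i) :=
  subsingleton_reducedHomology_of_cone v fun _ hF =>
    ⟨insert_mem_independenceComplex hF.1 fun a ha => hiso a (hF.2 ha),
      Finset.insert_subset hv hF.2⟩

/-- For a leaf `x` of the subgraph induced on `W`, the complex is the suspension of the link of
`σ x`.  This link is a cone if `σ x` has a neighbour other than `x`, and otherwise belongs to the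
set `W` with the matching edge at `x` removed. -/
lemma IsFavaronMatching.subsingleton_reducedHomology (hσ : G.IsFavaronMatching σ)
    (hu : G.IsUncrossed σ) {W : Finset V} (hW : ∀ v ∈ W, σ v ∈ W) {i : ℤ}
    (hi : 2 * (i + 1) < W.card) :
    Subsingleton (reducedHomology k (G.independenceComplexOn W) i) := by
  induction W using Finset.strongInduction generalizing i with
  | H W ih =>
    obtain rfl | hne := W.eq_empty_or_nonempty
    · rw [Finset.card_empty] at hi
      exact subsingleton_reducedHomology_of_lt (by lia)
    obtain ⟨x, hx, hleaf⟩ := hσ.exists_leaf hu hW hne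
    refine subsingleton_reducedHomology_of_suspension x (σ x) (fun F hF hxF => ?_) ?_
    · exact ⟨insert_mem_independenceComplex hF.1 fun a ha hxa =>
        hxF (hleaf a (hF.2 ha) hxa ▸ ha), Finset.insert_subset hx hF.2⟩
    rw [link_independenceComplexOn (F := {σ x}) ⟨singleton_mem_independenceComplex _,
      Finset.singleton_subset_iff.2 (hW x hx)⟩]
    by_cases hcone : ∃ u ∈ W, G.Adj (σ x) u ∧ u ≠ x
    · obtain ⟨u, huW, hxu, hne'⟩ := hcone
      refine subsingleton_reducedHomology_of_isolated (v := σ u) (mem_nonNeighbors.2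
        ⟨hW u huW, ?_, ?_⟩) (fun w hw huw => ?_) _
      · rw [Finset.mem_singleton]
        intro h'
        exact hne' (by rw [← hσ.invol u, h', hσ.invol])
      · simp only [Finset.mem_singleton, forall_eq]
        exact fun h' => hσ.not_adj hxu.symm h'.symm
      · exact (mem_nonNeighbors.1 hw).2.2 _ (Finset.mem_singleton_self _)
          (hσ.join hxu.symm huw)
    · push Not at hcone
      have heq : G.nonNeighbors W {σ x} = (W.erase x).erase (σ x) := by
        ext v
        simp only [mem_nonNeighbors, Finset.mem_singleton, forall_eq, Finset.mem_erase]
        refine ⟨fun ⟨h1, h2, h3⟩ => ⟨h2, ?_, h1⟩, fun ⟨h1, h2, h3⟩ =>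
          ⟨h3, h1, fun h' => h2 (hcone v h3 h')⟩⟩
        rintro rfl
        exact h3 (hσ.adj v).symm
      have hσx : σ x ∈ W.erase x := Finset.mem_erase.2 ⟨(hσ.adj x).ne.symm, hW x hx⟩
      rw [heq]
      refine ih _ ((Finset.erase_subset _ _).trans_ssubset (Finset.erase_ssubset hx))
        (fun v hv => ?_) ?_
      · simp only [Finset.mem_erase] at *
        refine ⟨fun h' => hv.2.1 ?_, fun h' => hv.1 ?_, hW v hv.2.2⟩
        · rw [← hσ.invol v, h', hσ.invol]
        · rw [← h', hσ.invol]
      · have h1 := Finset.card_erase_add_one hx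
        have h2 := Finset.card_erase_add_one hσx
        lia

/-- The link of a face is the independence complex of an induced subgraph.  A vertex of it whose
partner is missing is isolated; if there is none, the dimension of the link is at most half the
number of its vertices, minus one. -/
lemma IsFavaronMatching.subsingleton_reducedHomology_link [Fintype V]
    (hσ : G.IsFavaronMatching σ) (hu : G.IsUncrossed σ) {F : Finset V}
    (hF : F ∈ G.independenceComplex) {i : ℤ} (hi : i < dim (link G.independenceComplex F)) :
    Subsingleton (reducedHomology k (link G.independenceComplex F) i) := by
  rw [← independenceComplexOn_univ] at *
  rw [link_independenceComplexOn hF] at *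
  set W := G.nonNeighbors Finset.univ F with hWdef
  by_cases hW : ∀ v ∈ W, σ v ∈ W
  · refine hσ.subsingleton_reducedHomology hu hW ?_
    obtain ⟨A, hA, hdim⟩ := exists_faceDim_eq_dim (Δ := G.independenceComplexOn W) (F := ∅)
      ⟨by simp [mem_independenceComplex], Finset.empty_subset W⟩
    have := two_mul_card_le_of_involution hσ.invol hσ.adj hA.1 hA.2 hW
    rw [← hdim] at hi
    unfold faceDim at hi
    lia
  · push Not at hW
    obtain ⟨v, hv, hv'⟩ := hW
    refine subsingleton_reducedHomology_of_isolated hv (fun w hw hvw => ?_) i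
    have hvF := (mem_nonNeighbors.1 hv).2.2
    have hwF := (mem_nonNeighbors.1 hw).2.2
    refine hv' (mem_nonNeighbors.2 ⟨Finset.mem_univ _, fun h' => ?_, fun u hu' h' => ?_⟩)
    · exact hvF _ h' (hσ.adj v).symm
    · exact hwF u hu' (hσ.join hvw h'.symm).symm

/-! ### Cohen-Macaulay edge ideals give uncrossed matchings -/

/-- Suppose that the matching edges at `x` and `y` lie on a 4-cycle, and let `H` be maximal among
the independent sets that avoid all neighbours of `x` and `σ x`.  The vertices of the link of `H`
are neighbours of `x` or of `σ x`, and each of the former is adjacent to each of the latter, so the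
link is disconnected; its dimension is positive because it contains the face `{x, σ y}`. -/
lemma IsFavaronMatching.isUncrossed_of_link [Fintype V] (hσ : G.IsFavaronMatching σ)
    (hcm : ∀ F ∈ G.independenceComplex, 0 < dim (link G.independenceComplex F) →
      Subsingleton (reducedHomology k (link G.independenceComplex F) 0)) :
    G.IsUncrossed σ := by
  intro x y hxy hxy'
  by_contra hne
  obtain ⟨H, -, hH⟩ := (Set.toFinite {H : Finset V | H ∈ G.independenceComplex ∧
      ∀ h ∈ H, ¬ G.Adj x h ∧ ¬ G.Adj (σ x) h}).exists_le_maximal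
    (a := ∅) ⟨by simp [mem_independenceComplex], by simp⟩
  obtain ⟨hHi, hHx⟩ := hH.prop
  have hcm' := hcm H hHi
  rw [← independenceComplexOn_univ, link_independenceComplexOn
    (by rwa [independenceComplexOn_univ])] at hcm'
  set W := G.nonNeighbors Finset.univ H
  have hσx : G.Adj (σ x) x := (hσ.adj x).symm
  have hmemW : ∀ {v}, v ∉ H → (∀ h ∈ H, ¬ G.Adj h v) → v ∈ W := fun h1 h2 =>
    mem_nonNeighbors.2 ⟨Finset.mem_univ _, h1, h2⟩
  have hxW : x ∈ W := hmemW (fun h' => (hHx x h').2 hσx) fun h hh h' => (hHx h hh).1 h'.symm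
  have hσxW : σ x ∈ W := hmemW (fun h' => (hHx _ h').1 hσx.symm)
    fun h hh h' => (hHx h hh).2 h'.symm
  have hσyW : σ y ∈ W := hmemW (fun h' => (hHx _ h').2 hxy')
    fun h hh h' => (hHx h hh).1 (hσ.join hxy.symm h'.symm)
  have hWx : ∀ w ∈ W, ¬ G.Adj x w → G.Adj (σ x) w := by
    intro w hw h1
    by_contra h2
    obtain ⟨-, hwH, hwadj⟩ := mem_nonNeighbors.1 hw
    refine hwH (hH.le_of_ge ⟨insert_mem_independenceComplex hHi fun a ha h' =>
      hwadj a ha h'.symm, fun h hh => ?_⟩ (Finset.subset_insert w H) (Finset.mem_insert_self w H))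
    rcases Finset.mem_insert.1 hh with rfl | hh
    exacts [⟨h1, h2⟩, hHx h hh]
  have hedge : ({x, σ y} : Finset V) ∈ G.independenceComplexOn W := by
    refine ⟨insert_mem_independenceComplex (singleton_mem_independenceComplex _) ?_, ?_⟩
    · simp only [Finset.mem_singleton, forall_eq]
      exact fun h' => hσ.not_adj hxy.symm h'.symm
    · exact Finset.insert_subset hxW (Finset.singleton_subset_iff.2 hσyW)
  have hdim := faceDim_le_dim hedge
  rw [faceDim, Finset.card_pair (fun h' => hne (by rw [h', hσ.invol]))] at hdim
  refine not_subsingleton_reducedHomology_zero (k := k) (G.Adj x) (fun a b ha hb hab => ?_)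
    (x := σ x) (y := x) ?_ ?_ hσx.symm (G.irrefl) (hcm' (by lia))
  · exact mem_independenceComplex.1 hab.1 a (by simp) b (by simp)
      (hσ.join ha (hWx b (hab.2 (by simp)) hb))
  · exact ⟨singleton_mem_independenceComplex _, Finset.singleton_subset_iff.2 hσxW⟩
  · exact ⟨singleton_mem_independenceComplex _, Finset.singleton_subset_iff.2 hxW⟩

end Homology

/-- A product of variables over an independent set is not in the edge ideal: substituting `1` for
these variables and `0` for the others maps it to `1`, and maps the edge ideal to zero. -/
lemma stanleyReisnerComplex_edgeIdeal (k : Type*) [Field k] (G : SimpleGraph V) :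
    stanleyReisnerComplex (G.edgeIdeal k) = G.independenceComplex := by
  classical
  refine SetLike.ext fun W => ⟨fun hW => ?_, fun hW hmem => ?_⟩
  · rw [mem_independenceComplex]
    intro u hu v hv huv
    refine hW (Ideal.mem_of_dvd _ ?_ (Ideal.subset_span ⟨u, v, huv, rfl⟩))
    rw [← Finset.prod_pair huv.ne]
    exact Finset.prod_dvd_prod_of_subset _ _ _
      (Finset.insert_subset hu (Finset.singleton_subset_iff.2 hv))
  · let e : MvPolynomial V k →+* k := MvPolynomial.eval fun v => if v ∈ W then 1 else 0
    have hle : G.edgeIdeal k ≤ RingHom.ker e := by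
      refine Ideal.span_le.2 ?_
      rintro _ ⟨u, v, huv, rfl⟩
      have : u ∉ W ∨ v ∉ W := by
        by_contra! h'
        exact mem_independenceComplex.1 hW u h'.1 v h'.2 huv
      rcases this with h' | h' <;> simp [e, h']
    have h1 : e (∏ v ∈ W, MvPolynomial.X v) = 1 := by
      rw [map_prod]
      exact Finset.prod_eq_one fun v hv => by simp [e, hv]
    exact one_ne_zero (h1.symm.trans (hle hmem))

/-! ### The boundary -/

section Boundary

variable [Fintype V]

lemma IsFavaronMatching.nonempty_iso_disjointEdges (hσ : G.IsFavaronMatching σ)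
    (h : G.IsVeryWellCovered) {d : ℕ} (hcard : Fintype.card V = 2 * d)
    (hadj : ∀ v w, G.Adj v w → w = σ v) : Nonempty (G ≃g disjointEdges d) := by
  obtain ⟨F, hF, -⟩ := exists_isFacet_of_mem (Δ := G.independenceComplex) (F := ∅)
    (by simp [mem_independenceComplex])
  have hFd : F.card = d := by
    have := h.two_mul_card_eq hF
    lia
  have hFi := mem_independenceComplex.1 hF.prop
  let e : Fin d ≃ F := (F.equivFinOfCardEq hFd).symm
  let f : Fin d × Bool → V := fun p => if p.2 then σ (e p.1) else e p.1
  have hne : ∀ i j, (e i : V) ≠ σ (e j) := fun i j h' =>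
    hFi _ (e j).2 _ (e i).2 (h' ▸ hσ.adj _)
  have hinj : ∀ {i j}, (e i : V) = e j → i = j := fun h' => e.injective (Subtype.ext h')
  have hσinj : Function.Injective σ := Function.LeftInverse.injective hσ.invol
  have hf : Function.Bijective f := by
    rw [Fintype.bijective_iff_injective_and_card]
    refine ⟨?_, by simp [hcard, mul_comm]⟩
    rintro ⟨i, a⟩ ⟨j, b⟩ h'
    cases a <;> cases b <;> simp only [f, if_true, Bool.false_eq_true, if_false] at h'
    · rw [hinj h']
    · exact absurd h' (hne i j)
    · exact absurd h'.symm (hne j i)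
    · rw [hinj (hσinj h')]
  have hiff : ∀ v w, G.Adj v w ↔ w = σ v := fun v w => ⟨hadj v w, fun h' => h' ▸ hσ.adj v⟩
  refine ⟨RelIso.symm ⟨Equiv.ofBijective f hf, ?_⟩⟩
  rintro ⟨i, a⟩ ⟨j, b⟩
  rw [hiff]
  cases a <;> cases b <;>
    simp only [f, Equiv.ofBijective_apply, if_true, Bool.false_eq_true, if_false, disjointEdges,
      ne_eq, not_true, and_false, iff_false, hσ.invol, not_false_eq_true, and_true,
      Bool.true_eq_false]
  · exact hne j i
  · exact ⟨fun h' => (hinj (hσinj h')).symm, fun h' => by rw [h']⟩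
  · exact ⟨fun h' => (hinj h').symm, fun h' => by rw [h']⟩
  · exact fun h' => hne i j h'.symm

variable [DecidableEq V]

/-- If `G` is a disjoint union of edges, then each of the two ends of the matching edge missed by a
face of codimension one completes that face to a facet.  Otherwise some `x` has a neighbour
`y ≠ σ x`, and for a facet `F` containing `y` the face `F \ {σ x}` lies in no other facet, as such
a facet would contain both `x` and `y`. -/
lemma IsFavaronMatching.hasBoundary_iff (hσ : G.IsFavaronMatching σ)
    (h : G.IsVeryWellCovered) {d : ℕ} (hcard : Fintype.card V = 2 * d) :
    HasBoundary G.independenceComplex ↔ ¬ Nonempty (G ≃g disjointEdges d) := by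
  constructor
  · rintro ⟨H, hH, hdim, F, ⟨hF, hHF⟩, huniq⟩ ⟨e⟩
    have hadj : ∀ v w, G.Adj v w → w = σ v := by
      intro v w hvw
      have h1 : (disjointEdges d).Adj (e v) (e w) := e.map_adj_iff.2 hvw
      have h2 : (disjointEdges d).Adj (e v) (e (σ v)) := e.map_adj_iff.2 (hσ.adj v)
      refine e.injective (Prod.ext (h1.1.symm.trans h2.1) ?_)
      have h3 := h1.2
      have h4 := h2.2
      revert h3 h4
      generalize (e v).2 = a, (e w).2 = b, (e (σ v)).2 = c
      revert a b c
      decide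
    obtain ⟨x, hxF, hxH⟩ : ∃ x ∈ F, x ∉ H := by
      by_contra! hc
      rw [← h.faceDim_eq_dim hF, hHF.antisymm hc] at hdim
      lia
    have hσx : σ x ∉ F := fun h' => mem_independenceComplex.1 hF.prop x hxF _ h' (hσ.adj x)
    have hflip := hσ.isFacet_flip h hF hσx fun a _ ha => hadj _ a ha
    rw [hσ.invol] at hflip
    refine hσx (huniq _ ⟨hflip, fun v hv => ?_⟩ ▸ Finset.mem_insert_self _ _)
    exact Finset.mem_insert_of_mem (Finset.mem_erase.2 ⟨fun h' => hxH (h' ▸ hv), hHF hv⟩)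
  · contrapose!
    intro hnb
    refine hσ.nonempty_iso_disjointEdges h hcard fun x y hxy => ?_
    by_contra hne
    obtain ⟨F, hF, hyF⟩ := exists_isFacet_of_mem (singleton_mem_independenceComplex (G := G) y)
    rw [Finset.singleton_subset_iff] at hyF
    have hx : ∀ A, IsFacet G.independenceComplex A → y ∈ A → σ x ∈ A := fun A hA hyA =>
      (hσ.mem_or_mem hA x).resolve_left fun hxA =>
        mem_independenceComplex.1 hA.prop x hxA y hyA hxy
    refine hnb ⟨F.erase (σ x), G.independenceComplex.lower (Finset.erase_subset _ _) hF.prop, ?_,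
      F, ⟨hF, Finset.erase_subset _ _⟩, fun A ⟨hA, hsub⟩ => ?_⟩
    · rw [← h.faceDim_eq_dim hF]
      have := Finset.card_erase_add_one (hx F hF hyF)
      unfold faceDim
      lia
    · have hσxA := hx A hA (hsub (Finset.mem_erase.2 ⟨hne, hyF⟩))
      refine (hF.eq_of_le hA.prop fun v hv => ?_).symm
      by_cases hvx : v = σ x
      · exact hvx ▸ hσxA
      · exact hsub (Finset.mem_erase.2 ⟨hvx, hv⟩)

end Boundary

end SimpleGraph

theorem mainTheorem3 {V : Type*} [Fintype V] [DecidableEq V] (k : Type*) [Field k]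
    (G : SimpleGraph V) (d : ℕ) (hd : 1 ≤ d) (hcard : Fintype.card V = 2 * d)
    (hvwc : G.IsVeryWellCovered) (hiso : ∀ v, ¬ G.IsIsolated v) :
    (SComplex.IsPseudomanifold G.independenceComplex ↔
      SComplex.IsCohenMacaulay (G.edgeIdeal k)) ∧
    (SComplex.IsPseudomanifold G.independenceComplex →
      (SComplex.HasBoundary G.independenceComplex ↔
        ¬ Nonempty (G ≃g SimpleGraph.disjointEdges d))) := by
  obtain ⟨σ, hσ⟩ := hvwc.exists_isFavaronMatching hiso
  refine ⟨⟨fun hpm => ?_, fun hcm => ?_⟩, fun _ => hσ.hasBoundary_iff hvwc hcard⟩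
  · have hu := hσ.isUncrossed_of_isStronglyConnected hvwc hpm.stronglyConnected
    unfold SComplex.IsCohenMacaulay
    rw [SimpleGraph.stanleyReisnerComplex_edgeIdeal]
    exact fun F hF i hi => hσ.subsingleton_reducedHomology_link hu hF hi
  · unfold SComplex.IsCohenMacaulay at hcm
    rw [SimpleGraph.stanleyReisnerComplex_edgeIdeal] at hcm
    have hu := hσ.isUncrossed_of_link fun F hF hi => hcm F hF 0 hi
    exact ⟨fun F F' hF hF' => (hvwc.faceDim_eq_dim hF).trans (hvwc.faceDim_eq_dim hF').symm,
      fun H hH hdim => hσ.isRidge hvwc hH hdim, hσ.isStronglyConnected hvwc hu⟩
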